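/- **Distribution estimation under communication constraints.** Let $d\ge 2$, let $\mathcal M_d=\{\theta\in[0,1]^d:\sum_{j=1}^d\theta_j=1\}$ be the probability simplex over $d$ elements, and for $\theta\in\mathcal M_d$ let $P_\theta=\mathsf{Multi}(1;\theta)$ be the law of a single draw from $\{1,\dots,d\}$ in which $j$ has probability $\theta_j$. There are $n$ sensors; sensor $i$ observes $X_i$, where $X_1,\dots,X_n$ are i.i.d. with law $P_\theta$. The sensors communicate by a blackboard protocol $\Pi_{\mathsf{BB}}$ with a $k$-bit constraint: given the outcome of a public random coin, which is independent of the samples, the protocol is a finite binary tree in which every internal node is labelled by the sensor that writes the next bit, together with a binary function of that sensor's sample giving the bit, which selects the next node; on every path from the root to a leaf each sensor writes at most $k$ bits. The transcript $Y$ is the sequence of all bits written, and an estimator $\hat\theta$ is a measurable $\mathbb R^d$-valued function of $Y$ and of the public coin. There is a universal constant $C>0$, independent of $n,k,d$, such that for all integers $k\ge 0$, $d\ge 2$ and $n\ge \frac{d^2}{\min\{2^k,d\}}$, $$\inf_{\Pi_{\mathsf{BB}}}\inf_{\hat\theta}\sup_{\theta\in\mathcal M_d}\mathbb E_\theta\|\hat\theta-\theta\|_2^2\;\ge\;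 C\cdot\max\left\{\frac{d}{n2^k},\frac1n\right\},$$ where the infima run over all blackboard protocols with the $k$-bit constraint and all estimators. -/

import Mathlib

open MeasureTheory
open scoped ENNReal

universe u

/-- A deterministic blackboard protocol among `n` sensors, sensor `i` holding a sample `x i : X`,
as a finite binary tree. At a leaf the communication is over. At an internal node, labelled by the
sensor `i` that writes the next bit, that sensor writes the bit `a (x i)`, and everybody moves on
to the child `next (a (x i))`. The node encodes all bits written so far, so the label and the
function `a` may depend on them. -/
inductive BlackboardProtocol (n : ℕ) (X : Type) : Type where
  | leaf : BlackboardProtocol n X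
  | write (i : Fin n) (a : X → Bool) (next : Bool → BlackboardProtocol n X) :
      BlackboardProtocol n X

namespace BlackboardProtocol

variable {n : ℕ} {X : Type}

/-- The final content of the blackboard when the samples are `x`. -/
def transcript : BlackboardProtocol n X → (Fin n → X) → List Bool
  | leaf, _ => []
  | write i a next, x => a (x i) :: transcript (next (a (x i))) x

/-- The largest number of nodes labelled `i` on a path from the root to a leaf, i.e. the largest
number of bits that sensor `i` can write. -/
def maxBits (i : Fin n) : BlackboardProtocol n X → ℕ
  | leaf => 0
  | write j _ next =>
      (if j = i then 1 else 0) + max (maxBits i (next false)) (maxBits i (next true))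

end BlackboardProtocol

/-- A blackboard protocol with public randomness in which each of the `n` sensors writes at most
`k` bits: a probability space `(Ω, μ)` (the public coin, independent of the samples), and for each
outcome of the coin a deterministic blackboard protocol within the budget. Private coins of the
sensors are covered, since they may be taken as parts of the public coin. -/
structure PublicCoinProtocol (n k : ℕ) (X : Type) : Type (u + 1) where
  Ω : Type u
  [mΩ : MeasurableSpace Ω]
  μ : Measure Ω
  [isProb : IsProbabilityMeasure μ]
  tree : Ω → BlackboardProtocol n X
  measurableSet_transcript :
    ∀ (x : Fin n → X) (y : List Bool), MeasurableSet {ω | (tree ω).transcript x = y}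
  maxBits_le : ∀ (ω : Ω) (i : Fin n), (tree ω).maxBits i ≤ k

attribute [instance] PublicCoinProtocol.mΩ PublicCoinProtocol.isProb

/-- An estimator of a `d`-dimensional parameter: a measurable function of the transcript and of
the public coin. -/
structure TranscriptEstimator {n k : ℕ} {X : Type} (P : PublicCoinProtocol.{u} n k X) (d : ℕ) :
    Type u where
  est : P.Ω → List Bool → (Fin d → ℝ)
  measurable_est : ∀ y : List Bool, Measurable fun ω => est ω y

/-- The law `Multi(1; θ)` of one draw from `d` elements, of which `j` has probability `θ j`. -/
noncomputable def multiOne {d : ℕ} (θ : Fin d → ℝ) : Measure (Fin d) :=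
  ∑ j : Fin d, ENNReal.ofReal (θ j) • Measure.dirac j

/-- The expected squared `ℓ²` loss at `θ`: the samples are i.i.d. with law `Multi(1; θ)` and
independent of the public coin. -/
noncomputable def distRisk {n k d : ℕ} (P : PublicCoinProtocol.{u} n k (Fin d))
    (T : TranscriptEstimator P d) (θ : Fin d → ℝ) : ℝ≥0∞ :=
  ∫⁻ ω, ∫⁻ x : Fin n → Fin d,
      ENNReal.ofReal (∑ j : Fin d, (T.est ω ((P.tree ω).transcript x) j - θ j) ^ 2)
    ∂(Measure.pi fun _ : Fin n => multiOne θ) ∂P.μ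

/-- The minimax risk of distribution estimation over the probability simplex on `d` elements from
`n` sensors, each holding one sample and writing at most `k` bits on the blackboard. -/
noncomputable def distMinimaxRisk (n k d : ℕ) : ℝ≥0∞ :=
  ⨅ P : PublicCoinProtocol.{u} n k (Fin d), ⨅ T : TranscriptEstimator P d,
    ⨆ θ ∈ stdSimplex ℝ (Fin d), distRisk P T θ

/-! Group `2m` elements, `m = d / 2`, into pairs and tilt each pair of the uniform law by `±ε/(2m)`
according to a sign vector `v`. An estimator with small risk must recover most signs, so it suffices
to bound what the transcript reveals about them.

For a product law, the probability of a transcript is a product of cell probabilities, one per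
sensor (`sum_transcript`). Comparing `v` with its flip at `j`, Le Cam's bound loses a sum over
sensors of chi-square terms of the cells, weighted by the cell probabilities of the other sensors
(`two_point_risk_le`).

Two facts bound the total over `j`. A single cell has chi-square terms of total at most `8ε²/m`,
however many pairs it meets (`sum_sq_pairParam_div_le`). With sensor `i` left out, the transcripts
have total weight at most `2^k`, since only nodes of `i` create mass (`sum_leaves_prod_erase_le`).
So a sensor contributes at most `8ε²/m * min(2^k, 4m)`, and `ε` is tuned so that `n` sensors leave
half of the signs undetermined. -/

namespace BlackboardProtocol

/-! ### Transcript laws under product weights. -/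

variable {n : ℕ} {X : Type}

/-- The set of possible transcripts: the leaves of the tree, each named by the path to it. -/
def leaves : BlackboardProtocol n X → Finset (List Bool)
  | leaf => {[]}
  | write _ _ next =>
      Finset.univ.biUnion fun b : Bool => (leaves (next b)).image (List.cons b)

/-- The samples of sensor `l` compatible with the transcript `y`. -/
def cell [Fintype X] : BlackboardProtocol n X → List Bool → Fin n → Finset X
  | leaf, _, _ => Finset.univ
  | write _ _ _, [], _ => ∅
  | write j a next, b :: y, l => (cell (next b) y l).filter fun x => l = j → a x = b

/-- The weights `w` with those of sensor `j` restricted to the set where `a` has value `b`. -/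
def restrictWeight (w : Fin n → X → ℝ) (j : Fin n) (a : X → Bool) (b : Bool) : Fin n → X → ℝ :=
  fun l x => if l = j → a x = b then w l x else 0

theorem restrictWeight_of_ne (w : Fin n → X → ℝ) {j l : Fin n} (h : l ≠ j) (a : X → Bool)
    (b : Bool) : restrictWeight w j a b l = w l := by
  funext x
  simp [restrictWeight, h]

theorem restrictWeight_nonneg {w : Fin n → X → ℝ} (hw : ∀ l x, 0 ≤ w l x) (j : Fin n)
    (a : X → Bool) (b : Bool) (l : Fin n) (x : X) : 0 ≤ restrictWeight w j a b l x := by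
  unfold restrictWeight
  split_ifs
  exacts [hw l x, le_rfl]

theorem sum_leaves_write (j : Fin n) (a : X → Bool) (next : Bool → BlackboardProtocol n X)
    (F : List Bool → ℝ) :
    ∑ y ∈ (write j a next).leaves, F y = ∑ b, ∑ y ∈ (next b).leaves, F (b :: y) := by
  rw [leaves, Finset.sum_biUnion]
  · refine Finset.sum_congr rfl fun b _ => ?_
    rw [Finset.sum_image]
    intro y _ z _ h
    simpa using h
  · intro b _ c _ hbc
    rw [Function.onFun, Finset.disjoint_left]
    intro y hy hy'
    simp only [Finset.mem_image] at hy hy'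
    obtain ⟨z, -, rfl⟩ := hy
    obtain ⟨z', -, h⟩ := hy'
    simp only [List.cons.injEq] at h
    exact hbc h.1.symm

theorem prod_restrictWeight (w : Fin n → X → ℝ) (j : Fin n) (a : X → Bool) (b : Bool)
    (x : Fin n → X) :
    ∏ l, restrictWeight w j a b l (x l) = if a (x j) = b then ∏ l, w l (x l) else 0 := by
  split_ifs with h
  · refine Finset.prod_congr rfl fun l _ => ?_
    simp only [restrictWeight]
    rw [if_pos]
    rintro rfl
    exact h
  · refine Finset.prod_eq_zero (Finset.mem_univ j) ?_
    simp [restrictWeight, h]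

variable [Fintype X]

theorem sum_cell_write (w : Fin n → X → ℝ) (j : Fin n) (a : X → Bool)
    (next : Bool → BlackboardProtocol n X) (b : Bool) (y : List Bool) (l : Fin n) :
    ∑ x ∈ (write j a next).cell (b :: y) l, w l x
      = ∑ x ∈ (next b).cell y l, restrictWeight w j a b l x := by
  rw [cell, Finset.sum_filter]
  rfl

/-- For a product weight, the law of the transcript is the product of the weights of the cells. -/
theorem sum_transcript [DecidableEq X] (t : BlackboardProtocol n X) (w : Fin n → X → ℝ)
    (F : List Bool → ℝ) :
    ∑ x : Fin n → X, (∏ l, w l (x l)) * F (t.transcript x)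
      = ∑ y ∈ t.leaves, (∏ l, ∑ x ∈ t.cell y l, w l x) * F y := by
  -- Reading a bit amounts to restricting the weights, which need not stay normalized; hence the
  -- generalization over `w`.
  induction t generalizing w F with
  | leaf =>
    simp only [transcript, leaves, cell, Finset.sum_singleton, ← Finset.sum_mul]
    rw [Finset.prod_univ_sum]
    simp
  | write j a next ih =>
    rw [sum_leaves_write]
    simp only [sum_cell_write]
    simp only [← ih _ _ fun y => F (_ :: y)]
    rw [Finset.sum_comm]
    refine Finset.sum_congr rfl fun x _ => ?_
    simp only [prod_restrictWeight, transcript, ite_mul, zero_mul]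
    simp

/-- The marginals may differ between sensors: a hybrid law with one marginal replaced is used in
`two_point_risk_le`. -/
theorem sum_leaves_prod [DecidableEq X] (t : BlackboardProtocol n X) (w : Fin n → X → ℝ)
    (hw : ∀ l, ∑ x, w l x = 1) :
    ∑ y ∈ t.leaves, ∏ l, ∑ x ∈ t.cell y l, w l x = 1 := by
  have h := sum_transcript t w fun _ => 1
  simp only [mul_one] at h
  rw [← h, ← Fintype.piFinset_univ, ← Finset.prod_univ_sum]
  simp [hw]

theorem sum_restrictWeight (w : Fin n → X → ℝ) (j : Fin n) (a : X → Bool) :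
    ∑ b, ∑ x, restrictWeight w j a b j x = ∑ x, w j x := by
  rw [Finset.sum_comm]
  refine Finset.sum_congr rfl fun x _ => ?_
  simp [restrictWeight]

/-- Leaving out the weights of sensor `i`, the transcripts have total weight at most two to the
number of bits that sensor `i` can write. -/
theorem sum_leaves_prod_erase_le (t : BlackboardProtocol n X) (i : Fin n) (w : Fin n → X → ℝ)
    (hw : ∀ l x, 0 ≤ w l x) :
    ∑ y ∈ t.leaves, ∏ l ∈ Finset.univ.erase i, ∑ x ∈ t.cell y l, w l x
      ≤ 2 ^ t.maxBits i * ∏ l ∈ Finset.univ.erase i, ∑ x, w l x := by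
  induction t generalizing w with
  | leaf => simp [leaves, cell, maxBits]
  | write j a next ih =>
    rw [sum_leaves_write]
    simp only [sum_cell_write]
    have hb : ∀ b, ((2 : ℝ)) ^ (next b).maxBits i
        ≤ 2 ^ max (maxBits i (next false)) (maxBits i (next true)) := by
      intro b
      refine pow_le_pow_right₀ one_le_two ?_
      cases b
      exacts [le_max_left _ _, le_max_right _ _]
    have hnn : ∀ b, 0 ≤ ∏ l ∈ Finset.univ.erase i, ∑ x, restrictWeight w j a b l x := fun b =>
      Finset.prod_nonneg fun l _ => Finset.sum_nonneg fun x _ => restrictWeight_nonneg hw j a b l x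
    refine (Finset.sum_le_sum fun b _ => (ih b _ (restrictWeight_nonneg hw j a b)).trans
      (mul_le_mul_of_nonneg_right (hb b) (hnn b))).trans ?_
    rw [← Finset.mul_sum, maxBits, pow_add]
    by_cases hji : j = i
    -- Only the omitted sensor is restricted, so both children have the same bound: a factor 2.
    · subst hji
      have h : ∀ b, ∏ l ∈ Finset.univ.erase j, ∑ x, restrictWeight w j a b l x
          = ∏ l ∈ Finset.univ.erase j, ∑ x, w l x := fun b =>
        Finset.prod_congr rfl fun l hl => by
          rw [restrictWeight_of_ne w (Finset.ne_of_mem_erase hl)]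
      simp only [h, if_true, Finset.sum_const, Finset.card_univ, Fintype.card_bool]
      apply le_of_eq
      simp
      ring
    -- The two restrictions split the mass of sensor `j`, so nothing is gained.
    · have hj : j ∈ Finset.univ.erase i := by simp [hji]
      rw [if_neg hji, pow_zero, one_mul]
      refine mul_le_mul_of_nonneg_left (le_of_eq ?_) (by positivity)
      have h : ∀ b, ∏ l ∈ Finset.univ.erase i, ∑ x, restrictWeight w j a b l x
          = (∑ x, restrictWeight w j a b j x)
            * ∏ l ∈ (Finset.univ.erase i).erase j, ∑ x, w l x := by
        intro b
        rw [← Finset.mul_prod_erase _ _ hj]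
        congr 1
        exact Finset.prod_congr rfl fun l hl => by
          rw [restrictWeight_of_ne w (Finset.ne_of_mem_erase hl)]
      simp only [h]
      rw [← Finset.sum_mul, sum_restrictWeight]
      exact Finset.mul_prod_erase _ (fun l => ∑ x, w l x) hj

end BlackboardProtocol

/-! ### Le Cam's two-point bound. -/

/-- A pointwise two-point bound for products of cell probabilities `r l` and `s l`. -/
theorem two_point_loss_le {ι : Type*} [Fintype ι] [DecidableEq ι] (r s : ι → ℝ)
    (hr : ∀ l, 0 ≤ r l) (hs : ∀ l, 0 ≤ s l) (hrs : ∀ l, r l = 0 ↔ s l = 0) (g a b : ℝ) :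
    (a - b) ^ 2 * (∏ l, r l - (∏ l, r l + ∏ l, s l) / 4
        - (∑ i, (∏ l ∈ Finset.univ.erase i, r l)
            * ((r i - s i) ^ 2 / s i + (r i - s i))) / 2)
      ≤ (∏ l, r l) * (g - a) ^ 2 + (∏ l, s l) * (g - b) ^ 2 := by
  by_cases h0 : ∃ i, r i = 0
  · obtain ⟨i₀, hi⟩ := h0
    have hp : ∏ l, r l = 0 := Finset.prod_eq_zero (Finset.mem_univ i₀) hi
    have hq : ∏ l, s l = 0 := Finset.prod_eq_zero (Finset.mem_univ i₀) ((hrs i₀).1 hi)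
    have hsum : ∑ i, (∏ l ∈ Finset.univ.erase i, r l)
            * ((r i - s i) ^ 2 / s i + (r i - s i)) = 0 := by
      refine Finset.sum_eq_zero fun i _ => ?_
      by_cases h : i = i₀
      · subst h
        simp [hi, (hrs i).1 hi]
      · rw [Finset.prod_eq_zero (i := i₀) (by simp [Ne.symm h]) hi, zero_mul]
    rw [hp, hq, hsum]
    simp
  · push Not at h0
    have hr' : ∀ l, 0 < r l := fun l => lt_of_le_of_ne (hr l) (Ne.symm (h0 l))
    have hs' : ∀ l, 0 < s l := fun l =>
      lt_of_le_of_ne (hs l) fun h => h0 l ((hrs l).2 h.symm)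
    have hp : 0 < ∏ l, r l := Finset.prod_pos fun l _ => hr' l
    have hsum : ∑ i, (∏ l ∈ Finset.univ.erase i, r l)
            * ((r i - s i) ^ 2 / s i + (r i - s i)) = (∏ l, r l) * ∑ i, (r i / s i - 1) := by
      rw [Finset.mul_sum]
      refine Finset.sum_congr rfl fun i _ => ?_
      rw [← Finset.mul_prod_erase _ _ (Finset.mem_univ i)]
      have := (hs' i).ne'
      field_simp
      ring
    have hqp : ∏ l, s l = (∏ l, r l) * ∏ l, (s l / r l) := by
      rw [← Finset.prod_mul_distrib]
      exact Finset.prod_congr rfl fun l _ => by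
        have := (hr' l).ne'
        field_simp
    set ρ := ∏ l, (s l / r l) with hρ
    have hρ0 : 0 < ρ := Finset.prod_pos fun l _ => div_pos (hs' l) (hr' l)
    have hsq : Real.sqrt ρ ^ 2 = ρ := Real.sq_sqrt hρ0.le
    have hsq0 : 0 < Real.sqrt ρ := Real.sqrt_pos.2 hρ0
    -- Apply `log x ≤ x - 1` to `√ρ` and to each `r i / s i`.
    have hlog : 1 - (∑ i, (r i / s i - 1)) / 2 ≤ Real.sqrt ρ := by
      have h1 := Real.log_le_sub_one_of_pos hsq0
      rw [Real.log_sqrt hρ0.le, hρ, Real.log_prod fun l _ => (div_pos (hs' l) (hr' l)).ne'] at h1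
      have h2 : ∑ i, -Real.log (s i / r i) ≤ ∑ i, (r i / s i - 1) :=
        Finset.sum_le_sum fun i _ => by
          rw [← Real.log_inv, inv_div]
          exact Real.log_le_sub_one_of_pos (div_pos (hr' i) (hs' i))
      rw [Finset.sum_neg_distrib] at h2
      linarith
    rw [hsum, hqp]
    set p := ∏ l, r l
    set z := Real.sqrt ρ
    -- The minimum over `g` of the right side is `(a - b)² ρ / (1 + ρ)`; AM-GM in `h2` compares this
    -- with `z = √ρ`.
    have hkey : (a - b) ^ 2 * (z - (1 + ρ) / 4) ≤ (g - a) ^ 2 + ρ * (g - b) ^ 2 := by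
      have h1 : (a - b) ^ 2 * ρ ≤ ((g - a) ^ 2 + ρ * (g - b) ^ 2) * (1 + ρ) := by
        nlinarith [sq_nonneg ((g - a) + ρ * (g - b))]
      have h2 : (z - (1 + ρ) / 4) * (1 + ρ) ≤ ρ := by
        nlinarith [sq_nonneg (z - (1 + ρ) / 2)]
      refine le_of_mul_le_mul_right ?_ (by positivity : 0 < 1 + ρ)
      calc _ = (a - b) ^ 2 * ((z - (1 + ρ) / 4) * (1 + ρ)) := by ring
        _ ≤ (a - b) ^ 2 * ρ := mul_le_mul_of_nonneg_left h2 (sq_nonneg _)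
        _ ≤ _ := h1
    calc _ = p * ((a - b) ^ 2 * (1 - (∑ i, (r i / s i - 1)) / 2 - (1 + ρ) / 4)) := by ring
      _ ≤ p * ((a - b) ^ 2 * (z - (1 + ρ) / 4)) := by gcongr
      _ ≤ p * ((g - a) ^ 2 + ρ * (g - b) ^ 2) := by gcongr
      _ = _ := by ring

namespace BlackboardProtocol

variable {n : ℕ} {X : Type} [Fintype X] [DecidableEq X]

/-- Le Cam's two-point bound for the transcript, with the divergence of the two laws of the
transcript bounded sensor by sensor. -/
theorem two_point_risk_le (t : BlackboardProtocol n X) (w w' : X → ℝ) (hw : ∀ x, 0 ≤ w x)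
    (hw' : ∀ x, 0 ≤ w' x) (h1 : ∑ x, w x = 1) (h1' : ∑ x, w' x = 1)
    (h0 : ∀ C : Finset X, ∑ x ∈ C, w x = 0 ↔ ∑ x ∈ C, w' x = 0) (g : List Bool → ℝ) (a b : ℝ) :
    (a - b) ^ 2 / 2 * (1 - ∑ i, ∑ y ∈ t.leaves,
        (∏ l ∈ Finset.univ.erase i, ∑ x ∈ t.cell y l, w x)
          * ((∑ x ∈ t.cell y i, w x - ∑ x ∈ t.cell y i, w' x) ^ 2 / ∑ x ∈ t.cell y i, w' x))
      ≤ ∑ y ∈ t.leaves, (∏ l, ∑ x ∈ t.cell y l, w x) * (g y - a) ^ 2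
        + ∑ y ∈ t.leaves, (∏ l, ∑ x ∈ t.cell y l, w' x) * (g y - b) ^ 2 := by
  have hpt := Finset.sum_le_sum fun y (_ : y ∈ t.leaves) =>
    two_point_loss_le (fun l => ∑ x ∈ t.cell y l, w x) (fun l => ∑ x ∈ t.cell y l, w' x)
      (fun l => Finset.sum_nonneg fun x _ => hw x) (fun l => Finset.sum_nonneg fun x _ => hw' x)
      (fun l => h0 _) (g y) a b
  rw [← Finset.sum_add_distrib]
  refine le_trans (le_of_eq ?_) hpt
  have hP := sum_leaves_prod t (fun _ => w) fun _ => h1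
  have hQ := sum_leaves_prod t (fun _ => w') fun _ => h1'
  -- The linear terms cancel: both the law with all marginals `w` and the hybrid with `w'` at `i`
  -- have total mass 1.
  have hmix : ∀ i, ∑ y ∈ t.leaves, (∏ l ∈ Finset.univ.erase i, ∑ x ∈ t.cell y l, w x)
      * (∑ x ∈ t.cell y i, w x - ∑ x ∈ t.cell y i, w' x) = 0 := by
    intro i
    have hM := sum_leaves_prod t (Function.update (fun _ => w) i w') (by
      intro l
      by_cases h : l = i
      · subst h; simpa using h1'
      · simpa [h] using h1)
    have e1 : ∀ y, ∏ l, ∑ x ∈ t.cell y l, Function.update (fun _ => w) i w' l x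
        = (∏ l ∈ Finset.univ.erase i, ∑ x ∈ t.cell y l, w x) * ∑ x ∈ t.cell y i, w' x := by
      intro y
      rw [← Finset.prod_erase_mul _ _ (Finset.mem_univ i)]
      congr 1
      · exact Finset.prod_congr rfl fun l hl => by
          rw [Function.update_of_ne (Finset.ne_of_mem_erase hl)]
      · simp
    simp only [e1] at hM
    simp only [mul_sub, Finset.sum_sub_distrib, hM, Finset.prod_erase_mul _ _ (Finset.mem_univ i),
      hP, sub_self]
  rw [← Finset.mul_sum, Finset.sum_sub_distrib, Finset.sum_sub_distrib, ← Finset.sum_div,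
    ← Finset.sum_div, Finset.sum_add_distrib, hP, hQ]
  have hcomm : ∀ F : Fin n → List Bool → ℝ,
      ∑ y ∈ t.leaves, ∑ i, F i y = ∑ i, ∑ y ∈ t.leaves, F i y := fun F => Finset.sum_comm
  simp only [mul_add, Finset.sum_add_distrib, hcomm, hmix, Finset.sum_const_zero]
  ring

end BlackboardProtocol
-- The paired perturbations of the uniform law.
/-- The perturbation of the uniform distribution on `m` pairs: in the pair `j` the element singled
out by `v j` gains what the other one loses. -/
noncomputable def pairWeight {m : ℕ} (ε : ℝ) (v : Fin m → Bool) (p : Fin m × Bool) : ℝ :=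
  (1 + if v p.1 = p.2 then ε else -ε) / (2 * m)

/-- The perturbed uniform distribution on `m` pairs, placed on `Fin d` by `e`. -/
noncomputable def pairParam {m d : ℕ} (e : Fin m × Bool ↪ Fin d) (ε : ℝ) (v : Fin m → Bool)
    (x : Fin d) : ℝ :=
  ∑ p, if e p = x then pairWeight ε v p else 0

/-- The sign vector `v` with the coordinate `j` flipped. -/
def flipAt {m : ℕ} (j : Fin m) (v : Fin m → Bool) : Fin m → Bool :=
  Function.update v j (!v j)

section PairFamily

variable {m d : ℕ} (e : Fin m × Bool ↪ Fin d) {ε : ℝ}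

theorem flipAt_involutive (j : Fin m) : Function.Involutive (flipAt j) := by
  intro v
  simp [flipAt]

theorem sum_flipAt (j : Fin m) (f : (Fin m → Bool) → ℝ) : ∑ v, f (flipAt j v) = ∑ v, f v :=
  Equiv.sum_comp (flipAt_involutive j).toPerm f

theorem sum_pairParam (ε : ℝ) (v : Fin m → Bool) (C : Finset (Fin d)) :
    ∑ x ∈ C, pairParam e ε v x = ∑ p with e p ∈ C, pairWeight ε v p := by
  unfold pairParam
  rw [Finset.sum_comm, Finset.sum_filter]
  exact Finset.sum_congr rfl fun p _ => by simp

theorem pairParam_apply (ε : ℝ) (v : Fin m → Bool) (p : Fin m × Bool) :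
    pairParam e ε v (e p) = pairWeight ε v p := by
  simp [pairParam]

theorem le_pairWeight (hε : 0 ≤ ε) (hε' : ε ≤ 1 / 2) (v : Fin m → Bool) (p : Fin m × Bool) :
    1 / (4 * m) ≤ pairWeight ε v p := by
  have hm : (0 : ℝ) < m := Nat.cast_pos.2 (Fin.pos p.1)
  rw [pairWeight, div_le_div_iff₀ (by positivity) (by positivity)]
  split_ifs <;> nlinarith

theorem pairWeight_pos (hε : 0 ≤ ε) (hε' : ε ≤ 1 / 2) (v : Fin m → Bool) (p : Fin m × Bool) :
    0 < pairWeight ε v p := by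
  have hm : (0 : ℝ) < m := Nat.cast_pos.2 (Fin.pos p.1)
  exact lt_of_lt_of_le (by positivity) (le_pairWeight hε hε' v p)

theorem sum_pairWeight (hm : 0 < m) (ε : ℝ) (v : Fin m → Bool) : ∑ p, pairWeight ε v p = 1 := by
  have hm' : (m : ℝ) ≠ 0 := by positivity
  rw [Fintype.sum_prod_type]
  have h : ∀ j, ∑ b, pairWeight ε v (j, b) = 1 / m := by
    intro j
    unfold pairWeight
    cases h : v j <;> simp [h] <;> field_simp <;> ring
  rw [Finset.sum_congr rfl fun j _ => h j]
  simp [hm']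

theorem pairParam_nonneg (hε : 0 ≤ ε) (hε' : ε ≤ 1 / 2) (v : Fin m → Bool) (x : Fin d) :
    0 ≤ pairParam e ε v x := by
  refine Finset.sum_nonneg fun p _ => ?_
  split_ifs
  exacts [(pairWeight_pos hε hε' v p).le, le_rfl]

theorem sum_univ_pairParam (hm : 0 < m) (ε : ℝ) (v : Fin m → Bool) :
    ∑ x, pairParam e ε v x = 1 := by
  rw [sum_pairParam]
  simpa using sum_pairWeight hm ε v

theorem pairParam_mem_stdSimplex (hm : 0 < m) (hε : 0 ≤ ε) (hε' : ε ≤ 1 / 2)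
    (v : Fin m → Bool) : pairParam e ε v ∈ stdSimplex ℝ (Fin d) :=
  ⟨pairParam_nonneg e hε hε' v, sum_univ_pairParam e hm ε v⟩

/-- The condition on the right is free of `v`, so all members of the family have the same null sets.
-/
theorem sum_pairParam_eq_zero_iff (hε : 0 ≤ ε) (hε' : ε ≤ 1 / 2) (v : Fin m → Bool)
    (C : Finset (Fin d)) :
    ∑ x ∈ C, pairParam e ε v x = 0 ↔ (Finset.univ.filter fun p => e p ∈ C) = ∅ := by
  rw [sum_pairParam, Finset.sum_eq_zero_iff_of_nonneg fun p _ => (pairWeight_pos hε hε' v p).le,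
    Finset.eq_empty_iff_forall_notMem]
  exact forall_congr' fun p => ⟨fun h hp => (pairWeight_pos hε hε' v p).ne' (h hp),
    fun h hp => absurd hp h⟩

theorem pairWeight_sub_flipAt (hm : 0 < m) (ε : ℝ) (v : Fin m → Bool) (j : Fin m)
    (p : Fin m × Bool) :
    pairWeight ε v p - pairWeight ε (flipAt j v) p
      = if p.1 = j then (if v j = p.2 then ε / m else -(ε / m)) else 0 := by
  have hm' : (m : ℝ) ≠ 0 := by positivity
  obtain ⟨i, b⟩ := p
  unfold pairWeight flipAt
  by_cases h : i = j
  · subst h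
    cases v i <;> cases b <;> simp <;> field_simp <;> ring
  · simp [h]

theorem sq_pairWeight_sub_flipAt (hm : 0 < m) (ε : ℝ) (v : Fin m → Bool) (j : Fin m) (b : Bool) :
    (pairWeight ε v (j, b) - pairWeight ε (flipAt j v) (j, b)) ^ 2 = (ε / m) ^ 2 := by
  rw [pairWeight_sub_flipAt hm, if_pos rfl]
  split_ifs <;> ring

/-- Cauchy-Schwarz: only the at most two elements of `R` in the pair `j` contribute. -/
theorem sq_sum_pairWeight_sub_le (hm : 0 < m) (ε : ℝ) (v : Fin m → Bool) (j : Fin m)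
    (R : Finset (Fin m × Bool)) :
    (∑ p ∈ R, pairWeight ε v p - ∑ p ∈ R, pairWeight ε (flipAt j v) p) ^ 2
      ≤ 2 * (ε / m) ^ 2 * (R.filter fun p => p.1 = j).card := by
  rw [← Finset.sum_sub_distrib]
  simp only [pairWeight_sub_flipAt hm]
  rw [← Finset.sum_filter]
  refine sq_sum_le_card_mul_sum_sq.trans ?_
  have hcard : (R.filter fun p => p.1 = j).card ≤ 2 := by
    refine (Finset.card_le_card_of_injOn (t := (Finset.univ : Finset Bool)) Prod.snd
      (fun _ _ => Finset.mem_coe.2 (Finset.mem_univ _)) ?_).trans (by simp)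
    rintro ⟨i, b⟩ hi ⟨i', b'⟩ hi' h
    simp only [Finset.coe_filter, Set.mem_ofPred_eq] at hi hi' h
    simp [hi.2, hi'.2, h]
  have hsq : ∀ p : Fin m × Bool, (if v j = p.2 then ε / m else -(ε / m)) ^ 2 = (ε / m) ^ 2 := by
    intro p
    split_ifs <;> ring
  simp only [hsq, Finset.sum_const, nsmul_eq_mul]
  have h2 : ((R.filter fun p => p.1 = j).card : ℝ) ≤ 2 := by exact_mod_cast hcard
  calc _ ≤ 2 * (((R.filter fun p => p.1 = j).card : ℝ) * (ε / m) ^ 2) := by gcongr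
    _ = _ := by ring

/-- The total over the coordinates of the local chi-square terms of a set of samples. -/
theorem sum_sq_pairParam_div_le (hm : 0 < m) (hε : 0 ≤ ε) (hε' : ε ≤ 1 / 2) (v : Fin m → Bool)
    (C : Finset (Fin d)) :
    ∑ j, (∑ x ∈ C, pairParam e ε v x - ∑ x ∈ C, pairParam e ε (flipAt j v) x) ^ 2
        / ∑ x ∈ C, pairParam e ε (flipAt j v) x
      ≤ 8 * ε ^ 2 / m * min 1 (4 * m * ∑ x ∈ C, pairParam e ε v x) := by
  have hm' : (0 : ℝ) < m := by positivity
  simp only [sum_pairParam]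
  set R := Finset.univ.filter fun p => e p ∈ C with hR
  rcases R.eq_empty_or_nonempty with h | h
  · simp [h]
  have hc : (1 : ℝ) ≤ R.card := by exact_mod_cast h.card_pos
  have hlow : ∀ u : Fin m → Bool, (R.card : ℝ) / (4 * m) ≤ ∑ p ∈ R, pairWeight ε u p := by
    intro u
    have := Finset.card_nsmul_le_sum R _ _ fun p _ => le_pairWeight hε hε' u p
    rw [nsmul_eq_mul] at this
    simpa [div_eq_mul_inv] using this
  -- A nonempty `R` has weight at least `1/(4m)`. The minimum is kept so that either argument can be
  -- used when summing over leaves.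
  have hmin : min 1 (4 * m * ∑ p ∈ R, pairWeight ε v p) = 1 := by
    refine min_eq_left ?_
    have := hlow v
    rw [div_le_iff₀ (by positivity)] at this
    linarith
  rw [hmin, mul_one]
  have hcount : ∑ j, ((R.filter fun p => p.1 = j).card : ℝ) = R.card := by
    exact_mod_cast (Finset.card_eq_sum_card_fiberwise (f := Prod.fst) (s := R)
      (t := Finset.univ) (by simp)).symm
  calc _ ≤ ∑ j, (2 * (ε / m) ^ 2 * ((R.filter fun p => p.1 = j).card : ℝ))
        / ((R.card : ℝ) / (4 * m)) := by
        refine Finset.sum_le_sum fun j _ => ?_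
        exact div_le_div₀ (by positivity) (sq_sum_pairWeight_sub_le hm ε v j R) (by positivity)
          (hlow _)
    _ = 8 * ε ^ 2 / m := by
        rw [← Finset.sum_div, ← Finset.mul_sum, hcount]
        field_simp
        ring

end PairFamily

/-! ### Information per sensor and the Bayes risk. -/

namespace BlackboardProtocol

variable {n m d : ℕ} (e : Fin m × Bool ↪ Fin d) {ε : ℝ}

/-- The information about all coordinates that a single sensor contributes. -/
theorem sum_information_le (t : BlackboardProtocol n (Fin d)) (hm : 0 < m) (hε : 0 ≤ ε)
    (hε' : ε ≤ 1 / 2) (v : Fin m → Bool) (i : Fin n) {k : ℕ} (hk : t.maxBits i ≤ k) :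
    ∑ j, ∑ y ∈ t.leaves, (∏ l ∈ Finset.univ.erase i, ∑ x ∈ t.cell y l, pairParam e ε v x)
        * ((∑ x ∈ t.cell y i, pairParam e ε v x
            - ∑ x ∈ t.cell y i, pairParam e ε (flipAt j v) x) ^ 2
          / ∑ x ∈ t.cell y i, pairParam e ε (flipAt j v) x)
      ≤ 8 * ε ^ 2 / m * min ((2 : ℝ) ^ k) (4 * m) := by
  have hm' : (0 : ℝ) < m := by positivity
  have hnn : ∀ y, 0 ≤ ∏ l ∈ Finset.univ.erase i, ∑ x ∈ t.cell y l, pairParam e ε v x := fun y =>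
    Finset.prod_nonneg fun l _ => Finset.sum_nonneg fun x _ => pairParam_nonneg e hε hε' v x
  rw [Finset.sum_comm]
  simp only [← Finset.mul_sum]
  refine (Finset.sum_le_sum fun y _ => mul_le_mul_of_nonneg_left
    (sum_sq_pairParam_div_le e hm hε hε' v (t.cell y i)) (hnn y)).trans ?_
  simp only [mul_left_comm _ (8 * ε ^ 2 / (m : ℝ))]
  rw [← Finset.mul_sum]
  refine mul_le_mul_of_nonneg_left (le_min ?_ ?_) (by positivity)
  · calc _ ≤ ∑ y ∈ t.leaves, ∏ l ∈ Finset.univ.erase i, ∑ x ∈ t.cell y l, pairParam e ε v x :=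
          Finset.sum_le_sum fun y _ => mul_le_of_le_one_right (hnn y) (min_le_left _ _)
      _ ≤ 2 ^ t.maxBits i * ∏ l ∈ Finset.univ.erase i, ∑ x, pairParam e ε v x :=
          sum_leaves_prod_erase_le t i (fun _ => pairParam e ε v)
            fun _ => pairParam_nonneg e hε hε' v
      _ ≤ 2 ^ k := by
          simp only [sum_univ_pairParam e hm, Finset.prod_const_one, mul_one]
          exact pow_le_pow_right₀ one_le_two hk
  · calc _ ≤ ∑ y ∈ t.leaves, 4 * (m : ℝ) * ∏ l, ∑ x ∈ t.cell y l, pairParam e ε v x := by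
          refine Finset.sum_le_sum fun y _ =>
            (mul_le_mul_of_nonneg_left (min_le_right _ _) (hnn y)).trans (le_of_eq ?_)
          rw [← Finset.prod_erase_mul _ _ (Finset.mem_univ i)]
          ring
      _ = 4 * m := by
          rw [← Finset.mul_sum,
            sum_leaves_prod t (fun _ => pairParam e ε v) fun _ => sum_univ_pairParam e hm ε v,
            mul_one]

/-- The Bayes risk of a deterministic protocol under the uniform prior on the perturbations of the
uniform distribution. -/
theorem bayes_risk_le (t : BlackboardProtocol n (Fin d)) (hm : 0 < m) (hε : 0 ≤ ε)
    (hε' : ε ≤ 1 / 2) {k : ℕ} (hk : ∀ i, t.maxBits i ≤ k) (g : List Bool → Fin d → ℝ) :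
    2 ^ m * ((ε / m) ^ 2 / 4 * (m - n * (8 * ε ^ 2 / m * min ((2 : ℝ) ^ k) (4 * m))))
      ≤ ∑ v : Fin m → Bool, ∑ x : Fin n → Fin d, (∏ l, pairParam e ε v (x l))
          * ∑ j, (g (t.transcript x) j - pairParam e ε v j) ^ 2 := by
  have hnn := pairParam_nonneg e hε hε'
  -- the law of the transcript, the divergences, and the loss in one coordinate
  let P : (Fin m → Bool) → List Bool → ℝ := fun v y =>
    ∏ l, ∑ x ∈ t.cell y l, pairParam e ε v x
  let D : (Fin m → Bool) → Fin n → Fin m → ℝ := fun v i j =>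
    ∑ y ∈ t.leaves, (∏ l ∈ Finset.univ.erase i, ∑ x ∈ t.cell y l, pairParam e ε v x)
        * ((∑ x ∈ t.cell y i, pairParam e ε v x
            - ∑ x ∈ t.cell y i, pairParam e ε (flipAt j v) x) ^ 2
          / ∑ x ∈ t.cell y i, pairParam e ε (flipAt j v) x)
  let L : (Fin m → Bool) → Fin m → ℝ := fun v j =>
    ∑ y ∈ t.leaves, P v y * (g y (e (j, true)) - pairWeight ε v (j, true)) ^ 2
  have hpair : ∀ v j, (ε / m) ^ 2 / 2 * (1 - ∑ i, D v i j) ≤ L v j + L (flipAt j v) j := by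
    intro v j
    have h := two_point_risk_le t (pairParam e ε v) (pairParam e ε (flipAt j v)) (hnn _) (hnn _)
      (sum_univ_pairParam e hm ε _) (sum_univ_pairParam e hm ε _)
      (fun C => by rw [sum_pairParam_eq_zero_iff e hε hε', sum_pairParam_eq_zero_iff e hε hε'])
      (fun y => g y (e (j, true))) (pairWeight ε v (j, true))
      (pairWeight ε (flipAt j v) (j, true))
    rwa [sq_pairWeight_sub_flipAt hm] at h
  -- One element per pair already carries the sign; the loss at all other coordinates is dropped.
  have hcoord : ∀ v, ∑ j, L v j ≤ ∑ x : Fin n → Fin d, (∏ l, pairParam e ε v (x l))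
      * ∑ j, (g (t.transcript x) j - pairParam e ε v j) ^ 2 := by
    intro v
    have hL : ∀ j, L v j = ∑ x : Fin n → Fin d, (∏ l, pairParam e ε v (x l))
        * (g (t.transcript x) (e (j, true)) - pairWeight ε v (j, true)) ^ 2 := fun j =>
      (sum_transcript t (fun _ => pairParam e ε v)
        fun y => (g y (e (j, true)) - pairWeight ε v (j, true)) ^ 2).symm
    simp only [hL]
    rw [Finset.sum_comm]
    refine Finset.sum_le_sum fun x _ => ?_
    rw [← Finset.mul_sum]
    refine mul_le_mul_of_nonneg_left ?_ (Finset.prod_nonneg fun l _ => hnn v _)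
    simp only [← pairParam_apply e]
    have hinj : Function.Injective fun j : Fin m => e (j, true) := fun j j' h => by
      simpa using h
    rw [← Finset.sum_image (f := fun z => (g (t.transcript x) z - pairParam e ε v z) ^ 2)
      (g := fun j : Fin m => e (j, true)) hinj.injOn]
    exact Finset.sum_le_sum_of_subset_of_nonneg (Finset.subset_univ _) fun _ _ _ => sq_nonneg _
  have hinfo : ∀ v, ∑ j, ∑ i, D v i j ≤ n * (8 * ε ^ 2 / m * min ((2 : ℝ) ^ k) (4 * m)) := by
    intro v
    rw [Finset.sum_comm]
    refine (Finset.sum_le_sum fun i _ =>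
      sum_information_le e t hm hε hε' v i (hk i)).trans (le_of_eq ?_)
    simp
  have hsym : ∑ v, ∑ j, (L v j + L (flipAt j v) j) = 2 * ∑ v, ∑ j, L v j := by
    rw [Finset.sum_comm, Finset.sum_comm (f := fun v j => L v j), Finset.mul_sum]
    refine Finset.sum_congr rfl fun j _ => ?_
    rw [Finset.sum_add_distrib, sum_flipAt j fun v => L v j, two_mul]
  have hv : ∀ v, (ε / m) ^ 2 / 2 * (m - n * (8 * ε ^ 2 / m * min ((2 : ℝ) ^ k) (4 * m)))
      ≤ ∑ j, (L v j + L (flipAt j v) j) := by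
    intro v
    refine le_trans ?_ (Finset.sum_le_sum fun j _ => hpair v j)
    rw [← Finset.mul_sum, Finset.sum_sub_distrib]
    refine mul_le_mul_of_nonneg_left ?_ (by positivity)
    simp only [Finset.sum_const, Finset.card_univ, Fintype.card_fin, nsmul_eq_mul, mul_one]
    exact sub_le_sub_left (hinfo v) _
  have htotal := Finset.sum_le_sum fun v (_ : v ∈ Finset.univ) => hv v
  rw [hsym] at htotal
  simp only [Finset.sum_const, Finset.card_univ, Fintype.card_fun, Fintype.card_bool,
    Fintype.card_fin, nsmul_eq_mul, Nat.cast_pow, Nat.cast_ofNat] at htotal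
  refine le_trans ?_ (Finset.sum_le_sum fun v _ => hcoord v)
  linarith

end BlackboardProtocol

/-! ### From Bayes risk to minimax risk, with the public coin. -/

theorem multiOne_singleton {d : ℕ} (θ : Fin d → ℝ) (j : Fin d) :
    multiOne θ {j} = ENNReal.ofReal (θ j) := by
  simp [multiOne, Measure.finsetSum_apply, Set.indicator_apply, eq_comm]

instance isFiniteMeasure_multiOne {d : ℕ} (θ : Fin d → ℝ) : IsFiniteMeasure (multiOne θ) := by
  constructor
  simp only [multiOne, Measure.finsetSum_apply, Measure.smul_apply, smul_eq_mul]
  exact ENNReal.sum_lt_top.2 fun j _ => by simp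

theorem lintegral_pi_multiOne {n d : ℕ} {θ : Fin d → ℝ} (hθ : ∀ j, 0 ≤ θ j)
    {f : (Fin n → Fin d) → ℝ} (hf : ∀ x, 0 ≤ f x) :
    ∫⁻ x, ENNReal.ofReal (f x) ∂(Measure.pi fun _ : Fin n => multiOne θ)
      = ENNReal.ofReal (∑ x, (∏ l, θ (x l)) * f x) := by
  rw [lintegral_fintype, ENNReal.ofReal_sum_of_nonneg fun x _ =>
    mul_nonneg (Finset.prod_nonneg fun l _ => hθ _) (hf x)]
  refine Finset.sum_congr rfl fun x _ => ?_
  rw [Measure.pi_singleton, ENNReal.ofReal_mul (Finset.prod_nonneg fun l _ => hθ _),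
    ENNReal.ofReal_prod_of_nonneg fun l _ => hθ _, mul_comm]
  simp only [multiOne_singleton]

theorem TranscriptEstimator.measurable_est_transcript {n k d : ℕ} {X : Type}
    {P : PublicCoinProtocol.{u} n k X} (T : TranscriptEstimator P d) (x : Fin n → X) :
    Measurable fun ω => T.est ω ((P.tree ω).transcript x) := by
  let _ : MeasurableSpace (List Bool) := ⊤
  have h1 : Measurable fun ω => (P.tree ω).transcript x :=
    measurable_to_countable' fun y => P.measurableSet_transcript x y
  have h2 : Measurable fun q : P.Ω × List Bool => T.est q.1 q.2 :=
    measurable_from_prod_countable_left fun y => T.measurable_est y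
  exact h2.comp (measurable_id.prodMk h1)

/-- The supremum of the risk is at least the average over a finite family of parameters, which may
be bounded below for each outcome of the public coin separately. -/
theorem le_iSup_distRisk {n k d : ℕ} (P : PublicCoinProtocol.{u} n k (Fin d))
    (T : TranscriptEstimator P d) {ι : Type} [Fintype ι] [Nonempty ι] (θ : ι → Fin d → ℝ)
    (hθ : ∀ v, θ v ∈ stdSimplex ℝ (Fin d)) (c : ℝ)
    (hc : ∀ ω, Fintype.card ι * c ≤ ∑ v, ∑ x : Fin n → Fin d, (∏ l, θ v (x l))
      * ∑ j, (T.est ω ((P.tree ω).transcript x) j - θ v j) ^ 2) :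
    ENNReal.ofReal c ≤ ⨆ θ ∈ stdSimplex ℝ (Fin d), distRisk P T θ := by
  have hloss : ∀ (v : ι) (ω : P.Ω) (x : Fin n → Fin d),
      0 ≤ ∑ j, (T.est ω ((P.tree ω).transcript x) j - θ v j) ^ 2 := fun v ω x =>
    Finset.sum_nonneg fun j _ => sq_nonneg _
  have hrisk : ∀ v, distRisk P T (θ v) = ∫⁻ ω, ENNReal.ofReal (∑ x : Fin n → Fin d,
      (∏ l, θ v (x l)) * ∑ j, (T.est ω ((P.tree ω).transcript x) j - θ v j) ^ 2) ∂P.μ := fun v =>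
    lintegral_congr fun ω => lintegral_pi_multiOne (hθ v).1 (hloss v ω)
  have hmeas : ∀ v, Measurable fun ω => ENNReal.ofReal (∑ x : Fin n → Fin d,
      (∏ l, θ v (x l)) * ∑ j, (T.est ω ((P.tree ω).transcript x) j - θ v j) ^ 2) := by
    intro v
    refine ENNReal.measurable_ofReal.comp (Finset.measurable_sum _ fun x _ =>
      (Finset.measurable_sum _ fun j _ => ?_).const_mul _)
    exact (((measurable_pi_apply j).comp (T.measurable_est_transcript x)).sub_const _).pow_const 2
  have hcard : (Fintype.card ι : ℝ≥0∞) ≠ 0 := by simp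
  refine (ENNReal.mul_le_mul_iff_right hcard (ENNReal.natCast_ne_top _)).1 ?_
  calc (Fintype.card ι : ℝ≥0∞) * ENNReal.ofReal c
      = ∫⁻ _, ENNReal.ofReal (Fintype.card ι * c) ∂P.μ := by
        rw [lintegral_const, measure_univ, mul_one, ENNReal.ofReal_mul (Nat.cast_nonneg _),
          ENNReal.ofReal_natCast]
    _ ≤ ∫⁻ ω, ∑ v, ENNReal.ofReal (∑ x : Fin n → Fin d, (∏ l, θ v (x l))
          * ∑ j, (T.est ω ((P.tree ω).transcript x) j - θ v j) ^ 2) ∂P.μ := by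
        refine lintegral_mono fun ω => ?_
        rw [← ENNReal.ofReal_sum_of_nonneg]
        · exact ENNReal.ofReal_le_ofReal (hc ω)
        · exact fun v _ => Finset.sum_nonneg fun x _ =>
            mul_nonneg (Finset.prod_nonneg fun l _ => (hθ v).1 _) (hloss v ω x)
    _ = ∑ v, distRisk P T (θ v) := by
        rw [lintegral_finsetSum _ fun v _ => hmeas v]
        exact Finset.sum_congr rfl fun v _ => (hrisk v).symm
    _ ≤ ∑ _v : ι, ⨆ θ ∈ stdSimplex ℝ (Fin d), distRisk P T θ :=
        Finset.sum_le_sum fun v _ =>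
          le_iSup₂ (f := fun θ (_ : θ ∈ stdSimplex ℝ (Fin d)) => distRisk P T θ) (θ v) (hθ v)
    _ = _ := by simp

/-! ### Choice of the parameters. -/

theorem corollary2 :
    ∃ C : ℝ, 0 < C ∧ ∀ n k d : ℕ, 2 ≤ d →
      (d : ℝ) ^ 2 / min ((2 : ℝ) ^ k) (d : ℝ) ≤ (n : ℝ) →
        ENNReal.ofReal (C * max ((d : ℝ) / ((n : ℝ) * (2 : ℝ) ^ k)) (1 / (n : ℝ))) ≤
          distMinimaxRisk.{u} n k d := by
  -- `768 = 128 * 3 * 2`: the Bayes risk is `m / (128 n M)`, while `d ≤ 3m` and `M ≤ 2N`.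
  refine ⟨1 / 768, by norm_num, fun n k d hd hn => le_iInf fun P => le_iInf fun T => ?_⟩
  obtain ⟨m, hm⟩ : ∃ m, m = d / 2 := ⟨_, rfl⟩
  have hm0 : 0 < m := by omega
  have hm1 : (1 : ℝ) ≤ m := by exact_mod_cast hm0
  have hd2 : (2 : ℝ) * m ≤ d := by exact_mod_cast (by omega : 2 * m ≤ d)
  have hd3 : (d : ℝ) ≤ 3 * m := by exact_mod_cast (by omega : d ≤ 3 * m)
  obtain ⟨e⟩ : Nonempty (Fin m × Bool ↪ Fin d) :=
    Function.Embedding.nonempty_of_card_le (by simp; omega)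
  set N := min ((2 : ℝ) ^ k) (d : ℝ) with hN
  set M := min ((2 : ℝ) ^ k) (4 * m) with hM
  have h2k : (0 : ℝ) < 2 ^ k := by positivity
  have hd0 : (0 : ℝ) < d := by linarith
  have hN0 : 0 < N := lt_min h2k hd0
  have hNM : N ≤ M := min_le_min le_rfl (by linarith)
  have hMN : M ≤ 2 * N := by
    rw [hN, mul_min_of_nonneg _ _ zero_le_two]
    exact min_le_min (by linarith) (by linarith)
  have hM0 : 0 < M := hN0.trans_le hNM
  rw [div_le_iff₀ hN0] at hn
  have hn0 : (0 : ℝ) < n := by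
    by_contra h
    nlinarith
  have hnM : 4 * (m : ℝ) ^ 2 ≤ n * M := by nlinarith
  -- the size of the perturbation
  set ε := (m : ℝ) / (4 * Real.sqrt (n * M)) with hεdef
  have hnM0 : 0 < (n : ℝ) * M := by positivity
  have hsq : Real.sqrt (n * M) ^ 2 = n * M := Real.sq_sqrt hnM0.le
  have hs0 : 0 < Real.sqrt (n * M) := Real.sqrt_pos.2 hnM0
  have hε : 0 ≤ ε := by positivity
  have hεsq : ε ^ 2 = m ^ 2 / (16 * (n * M)) := by
    rw [hεdef, div_pow, mul_pow, hsq]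
    norm_num
  have hε' : ε ≤ 1 / 2 := by
    refine le_of_sq_le_sq ?_ (by norm_num)
    rw [hεsq, div_le_iff₀ (by positivity)]
    linarith
  have hmax : max ((d : ℝ) / (n * 2 ^ k)) (1 / n) = d / (n * N) := by
    rw [hN]
    rcases le_total ((2 : ℝ) ^ k) d with h | h
    · rw [min_eq_left h, max_eq_left]
      rw [div_le_div_iff₀ hn0 (by positivity)]
      nlinarith
    · rw [min_eq_right h, max_eq_right]
      · field_simp
      · rw [div_le_div_iff₀ (by positivity) hn0]
        nlinarith
  -- The choice of `ε` makes the subtracted information exactly `m / 2`.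
  have hval : (ε / m) ^ 2 / 4 * (m - n * (8 * ε ^ 2 / m * M)) = m / (128 * (n * M)) := by
    rw [div_pow, hεsq]
    field_simp
    ring
  have hle : 1 / 768 * max ((d : ℝ) / (n * 2 ^ k)) (1 / n) ≤ m / (128 * (n * M)) := by
    rw [hmax, div_mul_div_comm, one_mul, div_le_div_iff₀ (by positivity) (by positivity)]
    have : (d : ℝ) * M ≤ 3 * m * (2 * N) := by gcongr
    nlinarith
  refine (ENNReal.ofReal_le_ofReal hle).trans
    (le_iSup_distRisk P T (pairParam e ε) (pairParam_mem_stdSimplex e hm0 hε hε') _ fun ω => ?_)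
  have h := (P.tree ω).bayes_risk_le e hm0 hε hε' (P.maxBits_le ω) (T.est ω)
  rw [← hM, hval] at h
  simpa using h
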